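/- Let $\alpha\in\mathbb Z$, $n\in\mathbb Z_{\ge 0}$, $\epsilon=-n$, and let $\beta,\gamma,\delta,t,q\in\mathbb C$ satisfy $t\neq 0,1$ and $\gamma+\delta+\epsilon=\alpha+\beta+1$. Consider Heun's differential equation $$\frac{d^2y}{dz^2}+\left(\frac{\gamma}{z}+\frac{\delta}{z-1}+\frac{\epsilon}{z-t}\right)\frac{dy}{dz}+\frac{\alpha\beta z-q}{z(z-1)(z-t)}\,y=0,$$ and assume that the singularity $z=t$ (whose exponents are $0$ and $n+1$) is apparent, i.e. that there is a basis of local solutions at $z=t$ without logarithmic term: $f(z)=\sum_{j\ge0}c_j(z-t)^j$ and $g(z)=(z-t)^{n+1}\sum_{j\ge0}\tilde c_j(z-t)^j$ with convergent power series and $c_0\neq0$, $\tilde c_0\neq 0$. (i) If $\alpha>0$, then there is a non-zero polynomial $h$ of degree at most $\alpha+n-1$ such that $y(z)=z^{1-\gamma}(z-1)^{1-\delta}h(z)$ is a solution (that is, every holomorphic branch of this function on an open subset of $\mathbb C\setminus\{0,1,t\}$ is a solution there). (ii) If $\alpha<1-n$, then there is a non-zero polynomial solution $y(z)$ of degree at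 most $-\alpha$. (iii) If $1-n\le\alpha\le0$, then at least one of the following holds: there is a non-zero polynomial solution $y(z)$ of degree at most $-\alpha$, whose degree is exactly $-\alpha$ unless $\beta$ is an integer with $\alpha<\beta\le0$; or there is a non-zero polynomial $h$ of degree at most $\alpha+n-1$ such that $y(z)=z^{1-\gamma}(z-1)^{1-\delta}h(z)$ is a solution. -/

import Mathlib

open Filter Topology Polynomial

/-- Heun's differential equation
`y'' + (γ/z + δ/(z-1) + ε/(z-t)) y' + (αβz - q)/(z(z-1)(z-t)) y = 0` at the point `z`. -/
def HeunEqAt (α β γ δ ε t q : ℂ) (y : ℂ → ℂ) (z : ℂ) : Prop :=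
  deriv (deriv y) z + (γ / z + δ / (z - 1) + ε / (z - t)) * deriv y z
    + (α * β * z - q) / (z * (z - 1) * (z - t)) * y z = 0

/-- `y` is a (holomorphic) solution of Heun's equation on `U`; only used for open sets `U`
that do not contain `0`, `1`, `t`. -/
def IsHeunSolutionOn (α β γ δ ε t q : ℂ) (U : Set ℂ) (y : ℂ → ℂ) : Prop :=
  DifferentiableOn ℂ y U ∧ ∀ z ∈ U, HeunEqAt α β γ δ ε t q y z

/-- For `ε = -n`, `n` a natural number, the exponents at `z = t` are `0` and `n + 1`. The
singularity `z = t` is apparent if the local basis consisting of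
`f = ∑ cⱼ (z-t)^j + A g log (z-t)`, `c₀ ≠ 0`, and `g = (z-t)^(n+1) ∑ c̃ⱼ (z-t)^j`, `c̃₀ ≠ 0`,
has no logarithmic term (`A = 0`). Here `k` is the convergent power series in `g`. -/
def HeunApparent (α β γ δ : ℂ) (n : ℕ) (t q : ℂ) : Prop :=
  ∃ f k : ℂ → ℂ, AnalyticAt ℂ f t ∧ f t ≠ 0 ∧ AnalyticAt ℂ k t ∧ k t ≠ 0 ∧
    (∀ᶠ z in 𝓝[≠] t, HeunEqAt α β γ δ (-(n : ℂ)) t q f z) ∧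
    (∀ᶠ z in 𝓝[≠] t, HeunEqAt α β γ δ (-(n : ℂ)) t q (fun w => (w - t) ^ (n + 1) * k w) z)

/-- `L` is a holomorphic branch of `log (z - c)` on `U`. -/
def IsLogBranchOn (c : ℂ) (U : Set ℂ) (L : ℂ → ℂ) : Prop :=
  DifferentiableOn ℂ L U ∧ ∀ z ∈ U, Complex.exp (L z) = z - c

/-- The polynomial `p` is a solution of Heun's equation. -/
def IsHeunPolynomial (α β γ δ ε t q : ℂ) (p : ℂ[X]) : Prop :=
  IsHeunSolutionOn α β γ δ ε t q ({0, 1, t}ᶜ : Set ℂ) (fun z => p.eval z)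

/-- The multivalued function `z^σ₀ (z-1)^σ₁ h(z)` is a solution of Heun's equation: each of its
holomorphic branches, on each open set avoiding `0`, `1`, `t`, is a solution there. -/
def IsHeunPolynomialType (α β γ δ ε t q σ₀ σ₁ : ℂ) (h : ℂ[X]) : Prop :=
  ∀ U : Set ℂ, IsOpen U → U ⊆ ({0, 1, t}ᶜ : Set ℂ) →
    ∀ L₀ L₁ : ℂ → ℂ, IsLogBranchOn 0 U L₀ → IsLogBranchOn 1 U L₁ →
      IsHeunSolutionOn α β γ δ ε t q U
        (fun z => Complex.exp (σ₀ * L₀ z) * Complex.exp (σ₁ * L₁ z) * h.eval z)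

/-! In powers of `x = z - t` Heun's operator is tridiagonal. For `ε = -n` its superdiagonal entry
`heunDown` vanishes at `j = n + 1`, so the leading block `M` of size `n + 1` describes solutions
modulo `x ^ (n + 1)`. Truncating the power series `f` with `c₀ ≠ 0` gives a kernel vector, so `det M
= 0` (`HeunApparent.det_eq_zero`). The subdiagonal entry `heunUp` vanishes at `m = -α ≥ 0`, so
polynomials of degree at most `m` form an invariant subspace, and a singular block there yields a
polynomial solution. If `m ≥ n`, that block has `det M` as a factor. If `m < n`, `det M` is the
product of this block's determinant and a complementary one. The gauge factor `z ^ (1 - γ) (z - 1) ^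
(1 - δ)` replaces `α` by `1 - α - n` and reflects `M` in its antidiagonal (`heunEntry_gauge`). This
turns the complementary block into a leading one, and reduces `α > 0` to the case `m ≥ n`. -/

/-! ### Block and reflected determinants -/

/-- If the entries `F i j` with `i < a ≤ j` vanish, the leading `(a + b) × (a + b)` determinant
factors. -/
theorem det_of_upper_right_eq_zero (F : ℕ → ℕ → ℂ) (a b : ℕ)
    (hF : ∀ i j, i < a → a ≤ j → F i j = 0) :
    (Matrix.of fun i j : Fin (a + b) => F i j).det =
      (Matrix.of fun i j : Fin a => F i j).det *
        (Matrix.of fun i j : Fin b => F (a + i) (a + j)).det := by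
  rw [← Matrix.det_submatrix_equiv_self finSumFinEquiv,
    ← Matrix.det_fromBlocks_zero₁₂ _ (Matrix.of fun (i : Fin b) (j : Fin a) => F (a + i) j)]
  congr 1
  ext (i | i) (j | j) <;> simp [Matrix.fromBlocks]
  exact hF _ _ i.2 (by omega)

/-- If the entries `F i j` with `j < a ≤ i` vanish, the leading `(a + b) × (a + b)` determinant
factors. -/
theorem det_of_lower_left_eq_zero (F : ℕ → ℕ → ℂ) (a b : ℕ)
    (hF : ∀ i j, a ≤ i → j < a → F i j = 0) :
    (Matrix.of fun i j : Fin (a + b) => F i j).det =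
      (Matrix.of fun i j : Fin a => F i j).det *
        (Matrix.of fun i j : Fin b => F (a + i) (a + j)).det := by
  rw [← Matrix.det_submatrix_equiv_self finSumFinEquiv,
    ← Matrix.det_fromBlocks_zero₂₁ _ (Matrix.of fun (i : Fin a) (j : Fin b) => F i (a + j))]
  congr 1
  ext (i | i) (j | j) <;> simp [Matrix.fromBlocks]
  exact hF _ _ (by omega) j.2

/-- Reflecting a square matrix in its antidiagonal does not change the determinant. -/
theorem det_of_antitranspose (F G : ℕ → ℕ → ℂ) (N : ℕ)
    (h : ∀ i j, i < N → j < N → G i j = F (N - 1 - j) (N - 1 - i)) :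
    (Matrix.of fun i j : Fin N => G i j).det = (Matrix.of fun i j : Fin N => F i j).det := by
  rw [← Matrix.det_transpose, ← Matrix.det_submatrix_equiv_self Fin.revPerm
    (Matrix.of fun i j : Fin N => F i j)]
  congr 1
  ext i j
  have := h j i j.2 i.2
  simp only [Matrix.transpose_apply, Matrix.of_apply, Matrix.submatrix_apply, Fin.revPerm_apply,
    Fin.val_rev, this]
  congr 1 <;> omega

/-! ### Heun's operator as a tridiagonal matrix -/

/-- Coefficient of `x ^ (j + 1)` in the image of `x ^ j`, where `x = z - t`, under Heun's
operator. -/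
def heunUp (α β : ℂ) (j : ℕ) : ℂ := (j + α) * (j + β)

/-- Coefficient of `x ^ j` in the image of `x ^ j` under Heun's operator. -/
def heunDiag (α β γ δ ε t q : ℂ) (j : ℕ) : ℂ :=
  (2 * t - 1) * (j * (j - 1)) + j * (γ * (t - 1) + δ * t + ε * (2 * t - 1)) + α * β * t - q

/-- Coefficient of `x ^ (j - 1)` in the image of `x ^ j` under Heun's operator. -/
def heunDown (ε t : ℂ) (j : ℕ) : ℂ := t * (t - 1) * (j * (j - 1 + ε))

/-- Matrix of Heun's operator in the basis `(z - t) ^ j`. -/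
def heunEntry (α β γ δ ε t q : ℂ) (i j : ℕ) : ℂ :=
  if i = j then heunDiag α β γ δ ε t q j else if i = j + 1 then heunUp α β j
  else if j = i + 1 then heunDown ε t j else 0

/-- Heun's operator, multiplied by `z (z - 1) (z - t)`, on polynomials in `z - t`. -/
noncomputable def heunOp (α β γ δ ε t q : ℂ) : ℂ[X] →ₗ[ℂ] ℂ[X] :=
  LinearMap.mulLeft ℂ (X * (X + C t) * (X + C (t - 1))) ∘ₗ derivative ∘ₗ derivative +
  LinearMap.mulLeft ℂ (C γ * (X + C (t - 1)) * X + C δ * (X + C t) * X +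
    C ε * (X + C t) * (X + C (t - 1))) ∘ₗ derivative +
  LinearMap.mulLeft ℂ (C (α * β) * (X + C t) - C q)

theorem heunOp_apply (α β γ δ ε t q : ℂ) (P : ℂ[X]) :
    heunOp α β γ δ ε t q P =
      X * (X + C t) * (X + C (t - 1)) * derivative (derivative P) +
      (C γ * (X + C (t - 1)) * X + C δ * (X + C t) * X +
        C ε * (X + C t) * (X + C (t - 1))) * derivative P +
      (C (α * β) * (X + C t) - C q) * P := rfl

theorem heunOp_X_pow {α β γ δ ε : ℂ} (t q : ℂ) (hF : γ + δ + ε = α + β + 1) (j : ℕ) :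
    heunOp α β γ δ ε t q (X ^ j) = C (heunUp α β j) * X ^ (j + 1) +
      C (heunDiag α β γ δ ε t q j) * X ^ j + C (heunDown ε t j) * X ^ (j - 1) := by
  obtain rfl : ε = α + β + 1 - γ - δ := by linear_combination hF
  have hC : (C 2 : ℂ[X]) = 2 := rfl
  rw [heunOp_apply]
  rcases j with _ | _ | j
  · simp [heunUp, heunDiag, heunDown]
    ring
  · simp [heunUp, heunDiag, heunDown, hC]
    ring
  · have h1 : ((j + 2 : ℕ) : ℂ[X]) = (j : ℂ[X]) + 2 := by push_cast; ring
    have h2 : derivative (X ^ (j + 2) : ℂ[X]) = ((j : ℂ[X]) + 2) * X ^ (j + 1) := by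
      rw [derivative_X_pow, C_eq_natCast, h1]; rfl
    have h3 : derivative (((j : ℂ[X]) + 2) * X ^ (j + 1)) =
        ((j : ℂ[X]) + 2) * (((j : ℂ[X]) + 1) * X ^ j) := by
      simp [derivative_mul]
    rw [h2, h3]
    simp [heunUp, heunDiag, heunDown, hC]
    ring

theorem coeff_heunOp {α β γ δ ε : ℂ} (t q : ℂ) (hF : γ + δ + ε = α + β + 1) (P : ℂ[X]) {N : ℕ}
    (hP : P.natDegree < N) (i : ℕ) :
    (heunOp α β γ δ ε t q P).coeff i =
      ∑ j : Fin N, heunEntry α β γ δ ε t q i j * P.coeff j := by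
  have hX : ∀ j, (heunOp α β γ δ ε t q (X ^ j)).coeff i = heunEntry α β γ δ ε t q i j := by
    intro j
    rw [heunOp_X_pow t q hF, heunEntry]
    simp only [coeff_add, coeff_C_mul, coeff_X_pow]
    -- At `j = 0` the exponent `j - 1` truncates to `0`, harmlessly since `heunDown` vanishes there.
    rcases j with _ | j
    · rcases i with _ | _ | i <;> simp [heunDown]
    · by_cases h1 : i = j + 1
      · simp [h1]
      by_cases h2 : i = j + 2
      · simp [h2]
      by_cases h3 : i = j
      · simp [h3, show j ≠ j + 1 + 1 by omega]
      simp [h1, h2, h3, Ne.symm h3]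
  conv_lhs => rw [P.as_sum_range' N hP]
  rw [map_sum, finsetSum_coeff, Finset.sum_range]
  refine Finset.sum_congr rfl fun j _ => ?_
  rw [← C_mul_X_pow_eq_monomial, ← smul_eq_C_mul, map_smul, coeff_smul, hX, smul_eq_mul, mul_comm]

/-- The function `z ↦ P (z - t)` solves Heun's equation at `z` iff the polynomial operator
vanishes there. -/
theorem heunEqAt_comp_iff (α β γ δ ε t q : ℂ) (P : ℂ[X]) {z : ℂ} (h0 : z ≠ 0) (h1 : z ≠ 1)
    (ht : z ≠ t) :
    HeunEqAt α β γ δ ε t q (fun w => (P.comp (X - C t)).eval w) z ↔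
      (heunOp α β γ δ ε t q P).eval (z - t) = 0 := by
  have h1' : z - 1 ≠ 0 := sub_ne_zero.2 h1
  have ht' : z - t ≠ 0 := sub_ne_zero.2 ht
  have hd : ∀ Q : ℂ[X], deriv (fun w => (Q.comp (X - C t)).eval w) =
      fun w => ((derivative Q).comp (X - C t)).eval w := by
    intro Q
    funext w
    rw [Polynomial.deriv, derivative_comp]
    simp
  rw [HeunEqAt, hd, hd, ← mul_right_inj' (mul_ne_zero (mul_ne_zero h0 h1') ht'), mul_zero,
    heunOp_apply]
  simp only [eval_comp, eval_add, eval_sub, eval_mul, eval_X, eval_C]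
  refine iff_of_eq (congrArg (· = 0) ?_)
  field_simp
  ring

/-- A singular leading block that is invariant under Heun's operator yields a polynomial in its
kernel. -/
theorem exists_heunOp_eq_zero {α β γ δ ε : ℂ} (t q : ℂ) (hF : γ + δ + ε = α + β + 1) (m : ℕ)
    (hm : heunUp α β m = 0)
    (hdet : (Matrix.of fun i j : Fin (m + 1) => heunEntry α β γ δ ε t q i j).det = 0) :
    ∃ P : ℂ[X], P ≠ 0 ∧ P.natDegree ≤ m ∧ heunOp α β γ δ ε t q P = 0 := by
  obtain ⟨v, hv0, hv⟩ := Matrix.exists_mulVec_eq_zero_iff.2 hdet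
  let P : ℂ[X] := ∑ j : Fin (m + 1), monomial j (v j)
  have hc : ∀ j : Fin (m + 1), P.coeff j = v j := by
    intro j
    simp [P, coeff_monomial, Fin.val_inj]
  have hdeg : P.natDegree ≤ m := natDegree_sum_le_of_forall_le _ _ fun j _ =>
    (natDegree_monomial_le _).trans (by omega)
  refine ⟨P, fun h => hv0 (funext fun j => by rw [← hc, h]; simp), hdeg, ?_⟩
  ext i
  rw [coeff_heunOp t q hF P (Nat.lt_succ_of_le hdeg), coeff_zero]
  by_cases hi : i < m + 1
  · simpa [Matrix.mulVec, dotProduct, hc] using congrFun hv ⟨i, hi⟩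
  -- Below the block only the entry `(m + 1, m)` could survive, and it is `heunUp α β m = 0`.
  · refine Finset.sum_eq_zero fun j _ => ?_
    have : heunEntry α β γ δ ε t q i j = 0 := by
      have hj := j.2
      rw [heunEntry, if_neg (by omega)]
      split_ifs with h2 h3
      · rw [show (j : ℕ) = m by omega, hm]
      · omega
      · rfl
    rw [this, zero_mul]

/-- The degree of a polynomial in the kernel of Heun's operator is minus an exponent at
infinity. -/
theorem heunUp_natDegree_eq_zero {α β γ δ ε : ℂ} (t q : ℂ) (hF : γ + δ + ε = α + β + 1)
    {P : ℂ[X]} (hP : P ≠ 0) (h : heunOp α β γ δ ε t q P = 0) : heunUp α β P.natDegree = 0 := by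
  have h1 := coeff_heunOp t q hF P (Nat.lt_succ_self _) (P.natDegree + 1)
  rw [h, coeff_zero, Fin.sum_univ_castSucc, Finset.sum_eq_zero] at h1
  · simpa [heunEntry, hP] using h1.symm
  · intro j _
    have hj := j.2
    rw [heunEntry, if_neg, if_neg, if_neg, zero_mul] <;> simp <;> omega

theorem isHeunPolynomial_comp {α β γ δ ε t q : ℂ} {P : ℂ[X]}
    (h : heunOp α β γ δ ε t q P = 0) :
    IsHeunPolynomial α β γ δ ε t q (P.comp (X - C t)) := by
  refine ⟨(Polynomial.differentiable _).differentiableOn, fun z hz => ?_⟩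
  simp only [Set.mem_compl_iff, Set.mem_insert_iff, Set.mem_singleton_iff, not_or] at hz
  rw [heunEqAt_comp_iff _ _ _ _ _ _ _ _ hz.1 hz.2.1 hz.2.2, h, eval_zero]

theorem exists_heunPolynomial {α β γ δ ε : ℂ} (t q : ℂ) (hF : γ + δ + ε = α + β + 1) (m : ℕ)
    (hm : heunUp α β m = 0)
    (hdet : (Matrix.of fun i j : Fin (m + 1) => heunEntry α β γ δ ε t q i j).det = 0) :
    ∃ p : ℂ[X], p ≠ 0 ∧ p.natDegree ≤ m ∧ heunUp α β p.natDegree = 0 ∧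
      IsHeunPolynomial α β γ δ ε t q p := by
  obtain ⟨P, h0, hdeg, hP⟩ := exists_heunOp_eq_zero t q hF m hm hdet
  have hd : (P.comp (X - C t)).natDegree = P.natDegree := by simp [natDegree_comp]
  refine ⟨P.comp (X - C t), ?_, hd.trans_le hdeg, ?_, isHeunPolynomial_comp hP⟩
  · intro h
    rcases comp_eq_zero_iff.1 h with h | ⟨-, h⟩
    · exact h0 h
    · exact X_sub_C_ne_zero t (h.trans (by simpa using congrArg (coeff · 1) h))
  · rw [hd]; exact heunUp_natDegree_eq_zero t q hF h0 hP

/-! ### The gauge transformation -/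

/-- The gauge transformation by `z ^ (1 - γ) (z - 1) ^ (1 - δ)` reflects the matrix of Heun's
operator in its antidiagonal. -/
theorem heunEntry_gauge (α β γ δ t q : ℂ) (n : ℕ) (hF : γ + δ + (-(n : ℂ)) = α + β + 1) {i j : ℕ}
    (hi : i ≤ n) (hj : j ≤ n) :
    heunEntry (1 - α - n) (1 - β - n) (2 - γ) (2 - δ) (-(n : ℂ)) t
      (q + (2 - γ - δ) * t - n * (1 - γ)) i j =
    heunEntry α β γ δ (-(n : ℂ)) t q (n - j) (n - i) := by
  obtain rfl : δ = α + β + 1 + n - γ := by linear_combination hF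
  unfold heunEntry
  by_cases h1 : i = j
  · subst h1
    simp only [if_true, heunDiag, Nat.cast_sub hi]
    ring
  rw [if_neg h1, if_neg (show ¬n - j = n - i by omega)]
  -- Both factors of `heunUp` change sign under `j ↦ n - 1 - j` with the new parameters.
  by_cases h2 : i = j + 1
  · subst h2
    rw [if_pos rfl, if_pos (by omega)]
    simp only [heunUp, Nat.cast_sub hi]
    push_cast
    ring
  rw [if_neg h2, if_neg (show ¬n - j = n - i + 1 by omega)]
  -- `j * (j - 1 - n)` is invariant under `j ↦ n + 1 - j`.
  by_cases h3 : j = i + 1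
  · subst h3
    rw [if_pos rfl, if_pos (by omega)]
    simp only [heunDown, Nat.cast_sub hi]
    push_cast
    ring
  rw [if_neg h3, if_neg (show ¬n - i = n - j + 1 by omega)]

theorem IsLogBranchOn.hasDerivAt {c : ℂ} {U : Set ℂ} {L : ℂ → ℂ} (hU : IsOpen U)
    (hL : IsLogBranchOn c U L) {z : ℂ} (hz : z ∈ U) : HasDerivAt L (1 / (z - c)) z := by
  have hd : HasDerivAt L (deriv L z) z :=
    (hL.1.differentiableAt (hU.mem_nhds hz)).hasDerivAt
  have h1 : HasDerivAt (fun w => Complex.exp (L w)) (Complex.exp (L z) * deriv L z) z := hd.cexp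
  have h2 : HasDerivAt (fun w => Complex.exp (L w)) 1 z :=
    ((hasDerivAt_id z).sub_const c).congr_of_eventuallyEq
      (Filter.eventually_of_mem (hU.mem_nhds hz) hL.2)
  have h3 := h1.unique h2
  rw [hL.2 z hz] at h3
  have hne : z - c ≠ 0 := left_ne_zero_of_mul_eq_one h3
  rwa [eq_div_of_mul_eq hne ((mul_comm _ _).trans h3)] at hd

/-- If `h` is a polynomial solution of the gauge transformed equation, then
`z ^ (1 - γ) (z - 1) ^ (1 - δ) h` solves the original one. -/
theorem IsHeunPolynomial.polynomialType {α β γ δ t q : ℂ} {n : ℕ} {h : ℂ[X]}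
    (hF : γ + δ + (-(n : ℂ)) = α + β + 1)
    (hh : IsHeunPolynomial (1 - α - n) (1 - β - n) (2 - γ) (2 - δ) (-(n : ℂ)) t
      (q + (2 - γ - δ) * t - n * (1 - γ)) h) :
    IsHeunPolynomialType α β γ δ (-(n : ℂ)) t q (1 - γ) (1 - δ) h := by
  intro U hU hsub L₀ L₁ h₀ h₁
  have key : ∀ p : ℂ[X], ∀ z ∈ U, HasDerivAt
      (fun w => Complex.exp ((1 - γ) * L₀ w) * Complex.exp ((1 - δ) * L₁ w) * p.eval w)
      (Complex.exp ((1 - γ) * L₀ z) * Complex.exp ((1 - δ) * L₁ z) *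
        (((1 - γ) / z + (1 - δ) / (z - 1)) * p.eval z + (derivative p).eval z)) z := by
    intro p z hz
    have e0 := ((h₀.hasDerivAt hU hz).const_mul (1 - γ)).cexp
    have e1 := ((h₁.hasDerivAt hU hz).const_mul (1 - δ)).cexp
    refine ((e0.mul e1).mul (p.hasDerivAt z)).congr_deriv ?_
    simp only [sub_zero, Pi.mul_apply]
    ring
  refine ⟨fun z hz => (key h z hz).differentiableAt.differentiableWithinAt, fun z hz => ?_⟩
  have hz' := hsub hz
  have hsol := hh.2 z hz'
  simp only [Set.mem_compl_iff, Set.mem_insert_iff, Set.mem_singleton_iff, not_or] at hz'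
  obtain ⟨hz0, hz1, hzt⟩ := hz'
  have hz1' : z - 1 ≠ 0 := sub_ne_zero.2 hz1
  have hzt' : z - t ≠ 0 := sub_ne_zero.2 hzt
  -- In this form `y'` can be differentiated by `key` again, applied to `h` and to `derivative h`.
  have hev : deriv (fun w => Complex.exp ((1 - γ) * L₀ w) * Complex.exp ((1 - δ) * L₁ w) *
      h.eval w) =ᶠ[𝓝 z] fun w => ((1 - γ) / w + (1 - δ) / (w - 1)) *
        (Complex.exp ((1 - γ) * L₀ w) * Complex.exp ((1 - δ) * L₁ w) * h.eval w) +
        Complex.exp ((1 - γ) * L₀ w) * Complex.exp ((1 - δ) * L₁ w) * (derivative h).eval w := by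
    filter_upwards [hU.mem_nhds hz] with w hw
    rw [(key h w hw).deriv]
    ring
  have hr : HasDerivAt (fun w : ℂ => (1 - γ) / w + (1 - δ) / (w - 1))
      (-(1 - γ) / z ^ 2 + -(1 - δ) / (z - 1) ^ 2) z := by
    refine (((hasDerivAt_const z (1 - γ)).div (hasDerivAt_id z) hz0).add
      ((hasDerivAt_const z (1 - δ)).div ((hasDerivAt_id z).sub_const 1) hz1')).congr_deriv ?_
    simp
  have h2 := ((hr.mul (key h z hz)).add (key (derivative h) z hz)).congr_of_eventuallyEq hev
  rw [HeunEqAt, h2.deriv, (key h z hz).deriv]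
  have hdd : deriv (deriv fun w => h.eval w) z = (derivative (derivative h)).eval z := by
    rw [show (deriv fun w => h.eval w) = fun w => (derivative h).eval w from
      funext fun w => h.deriv, Polynomial.deriv]
  rw [HeunEqAt, hdd, Polynomial.deriv] at hsol
  obtain rfl : δ = α + β + 1 + n - γ := by linear_combination hF
  generalize Complex.exp ((1 - γ) * L₀ z) * Complex.exp ((1 - (α + β + 1 + n - γ)) * L₁ z) = E
  rw [← mul_zero E, ← hsol]
  field_simp
  ring

/-! ### Apparent singularity and the singular block -/

/-- Taylor's formula at `t` with analytic remainder. -/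
theorem AnalyticAt.exists_polynomial_add_pow_mul {f : ℂ → ℂ} {t : ℂ} (hf : AnalyticAt ℂ f t)
    (n : ℕ) : ∃ (P : ℂ[X]) (r : ℂ → ℂ), P.natDegree ≤ n ∧ P.coeff 0 = f t ∧ AnalyticAt ℂ r t ∧
      ∀ z, f z = P.eval (z - t) + (z - t) ^ (n + 1) * r z := by
  have hs : ∀ {g : ℂ → ℂ}, AnalyticAt ℂ g t → AnalyticAt ℂ (dslope g t) t := by
    rintro g ⟨p, hp⟩
    exact ⟨_, hp.has_fpower_series_dslope_fslope⟩
  have he : ∀ (g : ℂ → ℂ) z, g z = g t + (z - t) * dslope g t z := by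
    intro g z
    have := sub_smul_dslope g t z
    rw [smul_eq_mul] at this
    rw [this]; ring
  induction n with
  | zero => exact ⟨C (f t), dslope f t, by simp, by simp, hs hf, fun z => by
      simpa using he f z⟩
  | succ n ih =>
    obtain ⟨P, r, hP, h0, hr, h⟩ := ih
    refine ⟨P + C (r t) * X ^ (n + 1), dslope r t, ?_, by simpa, hs hr, fun z => ?_⟩
    · exact natDegree_add_le_of_degree_le (by omega) (natDegree_C_mul_X_pow_le _ _)
    · rw [h z, he r z]
      simp
      ring

/-- A polynomial that is `O(x ^ N)` at the origin has no coefficients below `N`. -/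
theorem Polynomial.coeff_eq_zero_of_eventually_eq_pow_mul {Q : ℂ[X]} {S : ℂ → ℂ} {t : ℂ} {N : ℕ}
    (hS : ContinuousAt S t) (h : ∀ᶠ z in 𝓝[≠] t, Q.eval (z - t) = (z - t) ^ N * S z) {i : ℕ}
    (hi : i < N) : Q.coeff i = 0 := by
  suffices hd : X ^ N ∣ Q from X_pow_dvd_iff.1 hd i hi
  by_cases hQ : Q = 0
  · simp [hQ]
  obtain ⟨R, hR, hnd⟩ := exists_eq_pow_rootMultiplicity_mul_and_not_dvd Q hQ 0
  set k := Q.rootMultiplicity 0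
  rw [dvd_iff_isRoot, IsRoot.def] at hnd
  rw [C_0, sub_zero] at hR
  by_cases hk : N ≤ k
  · rw [hR]; exact (pow_dvd_pow X hk).mul_right R
  exfalso
  apply hnd
  -- If the order `k` of the zero were below `N`, dividing by `(z - t) ^ k` and letting `z → t`
  -- would give `R(0) = 0`.
  obtain ⟨d, rfl⟩ : ∃ d, N = k + (d + 1) := ⟨N - k - 1, by omega⟩
  have h1 : Tendsto (fun z => R.eval (z - t)) (𝓝[≠] t) (𝓝 (R.eval (t - t))) :=
    ((R.continuous.comp (continuous_id.sub continuous_const)).tendsto t).mono_left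
      nhdsWithin_le_nhds
  have h2 : Tendsto (fun z => (z - t) ^ (d + 1) * S z) (𝓝[≠] t) (𝓝 ((t - t) ^ (d + 1) * S t)) :=
    ((((continuous_id.sub continuous_const).pow (d + 1)).tendsto t).mul hS).mono_left
      nhdsWithin_le_nhds
  have h3 : (fun z => R.eval (z - t)) =ᶠ[𝓝[≠] t] fun z => (z - t) ^ (d + 1) * S z := by
    filter_upwards [h, self_mem_nhdsWithin] with z hz hzt
    have hz0 : (z - t) ^ k ≠ 0 := pow_ne_zero _ (sub_ne_zero.2 hzt)
    rw [hR, eval_mul, eval_pow, eval_X, pow_add, mul_assoc] at hz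
    exact mul_left_cancel₀ hz0 hz
  simpa using tendsto_nhds_unique h1 (h2.congr' h3.symm)

/-- If `z = t` is apparent, then the leading block of size `n + 1` of Heun's operator is
singular. -/
theorem HeunApparent.det_eq_zero {α β γ δ t q : ℂ} {n : ℕ} (ht0 : t ≠ 0) (ht1 : t ≠ 1)
    (hF : γ + δ + (-(n : ℂ)) = α + β + 1) (happ : HeunApparent α β γ δ n t q) :
    (Matrix.of fun i j : Fin (n + 1) => heunEntry α β γ δ (-(n : ℂ)) t q i j).det = 0 := by
  obtain ⟨f, -, hf, hft, -, -, hsol, -⟩ := happ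
  obtain ⟨P, r, hP, hP0, hr, hfP⟩ := hf.exists_polynomial_add_pow_mul n
  have hr1 := hr.deriv
  have hr2 := hr1.deriv
  -- Minus the image of `x ^ (n + 1) * r`, divided by `x ^ (n + 1)`. The terms in `x ^ n` cancel
  -- because `n + 1` is an exponent at `t`.
  have hcont : ContinuousAt (fun z : ℂ => -(z * (z - 1) *
      (2 * (n + 1) * deriv r z + (z - t) * deriv (deriv r) z) +
      (γ * (z - 1) + δ * z) * ((n + 1) * r z + (z - t) * deriv r z) -
      n * z * (z - 1) * deriv r z + (α * β * z - q) * r z)) t := by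
    have := hr.continuousAt
    have := hr1.continuousAt
    have := hr2.continuousAt
    fun_prop
  have hQ : ∀ᶠ z in 𝓝[≠] t, (heunOp α β γ δ (-(n : ℂ)) t q P).eval (z - t) =
      (z - t) ^ (n + 1) * -(z * (z - 1) *
      (2 * (n + 1) * deriv r z + (z - t) * deriv (deriv r) z) +
      (γ * (z - 1) + δ * z) * ((n + 1) * r z + (z - t) * deriv r z) -
      n * z * (z - 1) * deriv r z + (α * β * z - q) * r z) := by
    have hd1 : ∀ z, AnalyticAt ℂ r z → HasDerivAt f ((derivative P).eval (z - t) +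
        ((n + 1) * (z - t) ^ n * r z + (z - t) ^ (n + 1) * deriv r z)) z := by
      intro z hz
      have hx : HasDerivAt (fun w : ℂ => w - t) 1 z := (hasDerivAt_id z).sub_const t
      have e1 := (P.hasDerivAt (z - t)).comp z hx
      have e2 := (hx.pow (n + 1)).mul hz.differentiableAt.hasDerivAt
      refine ((e1.add e2).congr_of_eventuallyEq (.of_forall hfP)).congr_deriv ?_
      simp
    have hd2 : ∀ z, (∀ᶠ w in 𝓝 z, AnalyticAt ℂ r w) → HasDerivAt (deriv f)
        ((derivative (derivative P)).eval (z - t) +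
        ((n + 1) * (n * (z - t) ^ (n - 1)) * r z + 2 * (n + 1) * (z - t) ^ n * deriv r z +
          (z - t) ^ (n + 1) * deriv (deriv r) z)) z := by
      intro z hz
      have hz0 := hz.self_of_nhds
      have hx : HasDerivAt (fun w : ℂ => w - t) 1 z := (hasDerivAt_id z).sub_const t
      have e1 := ((derivative P).hasDerivAt (z - t)).comp z hx
      have e2 := ((hx.pow n).const_mul ((n : ℂ) + 1)).mul hz0.differentiableAt.hasDerivAt
      have e3 := (hx.pow (n + 1)).mul hz0.deriv.differentiableAt.hasDerivAt
      refine ((e1.add (e2.add e3)).congr_of_eventuallyEq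
        (hz.mono fun w hw => (hd1 w hw).deriv)).congr_deriv ?_
      simp
      ring
    filter_upwards [hsol, self_mem_nhdsWithin,
      nhdsWithin_le_nhds hr.eventually_analyticAt.eventually_nhds,
      nhdsWithin_le_nhds (isOpen_ne.mem_nhds ht0), nhdsWithin_le_nhds (isOpen_ne.mem_nhds ht1)]
      with z hz hzt hzr hz0 hz1
    have hz0' : z ≠ 0 := hz0
    have hz1' : z - 1 ≠ 0 := sub_ne_zero.2 hz1
    have hzt' : z - t ≠ 0 := sub_ne_zero.2 hzt
    rw [HeunEqAt, (hd2 z hzr).deriv, (hd1 z hzr.self_of_nhds).deriv, hfP z] at hz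
    -- The factor `n` absorbs the truncated exponent when `n = 0`.
    have hpow : (n : ℂ) * (z - t) ^ (n - 1) * (z - t) = n * (z - t) ^ n := by
      rcases n with _ | n
      · simp
      · simp [pow_succ, mul_assoc]
    generalize (z - t) ^ (n - 1) = u at hz hpow
    rw [← mul_right_inj' (mul_ne_zero (mul_ne_zero hz0' hz1') hzt'), mul_zero] at hz
    rw [heunOp_apply]
    simp only [eval_add, eval_sub, eval_mul, eval_X, eval_C]
    field_simp at hz
    linear_combination hz - z * (z - 1) * (n + 1) * r z * hpow
  refine Matrix.exists_mulVec_eq_zero_iff.1 ⟨fun j => P.coeff j, fun h => hft ?_, ?_⟩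
  · rw [← hP0]; exact congrFun h 0
  · ext i
    have := coeff_heunOp t q hF P (Nat.lt_succ_of_le hP) i
    rw [Polynomial.coeff_eq_zero_of_eventually_eq_pow_mul hcont hQ i.2] at this
    simpa [Matrix.mulVec, dotProduct] using this.symm

/-- Larger leading blocks of Heun's operator are singular if the one of size `n + 1` is. -/
theorem det_heunEntry_eq_zero_of_le {α β γ δ t q : ℂ} {n m : ℕ} (hnm : n ≤ m)
    (h : (Matrix.of fun i j : Fin (n + 1) => heunEntry α β γ δ (-(n : ℂ)) t q i j).det = 0) :
    (Matrix.of fun i j : Fin (m + 1) => heunEntry α β γ δ (-(n : ℂ)) t q i j).det = 0 := by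
  obtain ⟨b, rfl⟩ := Nat.exists_eq_add_of_le hnm
  rw [show n + b + 1 = (n + 1) + b by omega, det_of_upper_right_eq_zero, h, zero_mul]
  intro i j hi hj
  rw [heunEntry, if_neg (by omega), if_neg (by omega)]
  split_ifs with hij
  · rw [show j = n + 1 by omega, heunDown]
    push_cast
    ring
  · rfl

/-! ### The three ranges of `α` -/

theorem mainTheorem5 (a : ℤ) (n : ℕ) (β γ δ t q : ℂ) (ht0 : t ≠ 0) (ht1 : t ≠ 1)
    (hfuchs : γ + δ + (-(n : ℂ)) = (a : ℂ) + β + 1)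
    (happ : HeunApparent (a : ℂ) β γ δ n t q) :
    (0 < a →
      ∃ h : ℂ[X], h ≠ 0 ∧ (h.natDegree : ℤ) ≤ a + n - 1 ∧
        IsHeunPolynomialType (a : ℂ) β γ δ (-(n : ℂ)) t q (1 - γ) (1 - δ) h) ∧
    (a < 1 - n →
      ∃ p : ℂ[X], p ≠ 0 ∧ (p.natDegree : ℤ) ≤ -a ∧
        IsHeunPolynomial (a : ℂ) β γ δ (-(n : ℂ)) t q p) ∧
    (1 - n ≤ a → a ≤ 0 →
      (∃ p : ℂ[X], p ≠ 0 ∧ (p.natDegree : ℤ) ≤ -a ∧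
        ((¬ ∃ m : ℤ, β = (m : ℂ) ∧ a < m ∧ m ≤ 0) → (p.natDegree : ℤ) = -a) ∧
        IsHeunPolynomial (a : ℂ) β γ δ (-(n : ℂ)) t q p) ∨
      (∃ h : ℂ[X], h ≠ 0 ∧ (h.natDegree : ℤ) ≤ a + n - 1 ∧
        IsHeunPolynomialType (a : ℂ) β γ δ (-(n : ℂ)) t q (1 - γ) (1 - δ) h)) := by
  have hdet := happ.det_eq_zero ht0 ht1 hfuchs
  have hF' : (2 - γ) + (2 - δ) + (-(n : ℂ)) = (1 - (a : ℂ) - n) + (1 - β - n) + 1 := by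
    linear_combination -hfuchs
  have hup : ∀ m : ℕ, (m : ℤ) = -a → heunUp (a : ℂ) β m = 0 := by
    intro m hm
    have : (m : ℂ) = -(a : ℂ) := by exact_mod_cast congrArg (Int.cast : ℤ → ℂ) hm
    rw [heunUp, this]; ring
  have hup' : ∀ m : ℕ, (m : ℤ) = a + n - 1 → heunUp (1 - (a : ℂ) - n) (1 - β - n) m = 0 := by
    intro m hm
    have : (m : ℂ) = (a : ℂ) + n - 1 := by exact_mod_cast congrArg (Int.cast : ℤ → ℂ) hm
    rw [heunUp, this]; ring
  have gauge : ∀ m : ℕ, (m : ℤ) = a + n - 1 →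
      (Matrix.of fun i j : Fin (m + 1) => heunEntry (1 - (a : ℂ) - n) (1 - β - n) (2 - γ) (2 - δ)
        (-(n : ℂ)) t (q + (2 - γ - δ) * t - n * (1 - γ)) i j).det = 0 →
      ∃ h : ℂ[X], h ≠ 0 ∧ (h.natDegree : ℤ) ≤ a + n - 1 ∧
        IsHeunPolynomialType (a : ℂ) β γ δ (-(n : ℂ)) t q (1 - γ) (1 - δ) h := by
    intro m hm hd
    obtain ⟨h, h0, hdeg, -, hh⟩ := exists_heunPolynomial t _ hF' m (hup' m hm) hd
    exact ⟨h, h0, by omega, hh.polynomialType hfuchs⟩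
  refine ⟨fun ha => ?_, fun ha => ?_, fun ha ha0 => ?_⟩
  · obtain ⟨m, hm⟩ : ∃ m : ℕ, (m : ℤ) = a + n - 1 := ⟨(a + n - 1).toNat, by omega⟩
    -- `a > 0` means `m ≥ n`, so the gauge-transformed block contains the reflected `M`.
    refine gauge m hm (det_heunEntry_eq_zero_of_le (by omega) ?_)
    rw [← hdet]
    exact det_of_antitranspose _ _ _ fun i j hi hj =>
      heunEntry_gauge _ _ _ _ _ _ _ hfuchs (by omega) (by omega)
  · obtain ⟨m, hm⟩ : ∃ m : ℕ, (m : ℤ) = -a := ⟨(-a).toNat, by omega⟩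
    obtain ⟨p, h0, hdeg, -, hp⟩ := exists_heunPolynomial t q hfuchs m (hup m hm)
      (det_heunEntry_eq_zero_of_le (by omega) hdet)
    exact ⟨p, h0, by omega, hp⟩
  · obtain ⟨m, hm⟩ : ∃ m : ℕ, (m : ℤ) = -a := ⟨(-a).toNat, by omega⟩
    obtain ⟨k, hk⟩ : ∃ k : ℕ, n = m + 1 + k := ⟨n - m - 1, by omega⟩
    -- Here `k = a + n - 1`, the degree bound for `h`, and `heunUp` at `m = -a` makes the lower left
    -- block zero.
    rw [show n + 1 = (m + 1) + (k + 1) by omega, det_of_lower_left_eq_zero, mul_eq_zero] at hdet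
    · rcases hdet with hdet | hdet
      · left
        obtain ⟨p, h0, hdeg, hpd, hp⟩ := exists_heunPolynomial t q hfuchs m (hup m hm) hdet
        refine ⟨p, h0, by omega, fun hβ => ?_, hp⟩
        by_contra hne
        -- The degree is `-a` or `-β`; a smaller degree forces `β` to be an integer in `(a, 0]`.
        rw [heunUp, mul_eq_zero] at hpd
        rcases hpd with hpd | hpd
        · have : (p.natDegree : ℤ) + a = 0 := by exact_mod_cast hpd
          omega
        · refine hβ ⟨-(p.natDegree : ℤ), ?_, by omega, by omega⟩
          push_cast
          linear_combination hpd
      · right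
        refine gauge k (by omega) ?_
        rw [← hdet]
        -- As `n = m + 1 + k`, `n - j = m + 1 + (k - j)`: reflection in `M` restricts to reflection
        -- of the complementary block.
        refine det_of_antitranspose (fun i j => heunEntry (a : ℂ) β γ δ (-(n : ℂ)) t q
          (m + 1 + i) (m + 1 + j)) _ _ fun i j hi hj => ?_
        rw [heunEntry_gauge _ _ _ _ _ _ _ hfuchs (by omega) (by omega)]
        congr 1 <;> omega
    · intro i j hi hj
      rw [heunEntry, if_neg (by omega)]
      split_ifs with h1 h2
      · rw [show j = m by omega, hup m hm]
      · omega
      · rfl
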